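/- Let $G$ be any graph with vertex set $V$. Conventions: - A finite order separation of $G$ is a set $\{A,B\}$ with $A\cup B=V$, $A\cap B$ finite, and no edge of $G$ between $A\setminus B$ and $B\setminus A$; the pairs $(A,B)$ and $(B,A)$ are its orientations, and $(A,B)\le(C,D)$ means $A\subseteq C$ and $B\supseteq D$. An orientation of the set $S$ of all finite order separations is a set $O$ of orientations of elements of $S$ containing precisely one of $(A,B),(B,A)$ for each $\{A,B\}\in S$; it is consistent if no two distinct $(B,A),(C,D)\in O$ satisfy $(A,B)<(C,D)$. A star is a set $\sigma$ of oriented finite order separations such that $(A,B)\le (C,D)$ for all distinct $(A,B),(D,C)\in\sigma$; its interior is $\bigcap_{(A,B)\in\sigma}B$. An $\aleph_0$-tangle of $G$ is a consistent orientation of $S$ no subset of which is a finite star of finite interior. - For finite $X\subseteq V$ let $\mathcal C_X$ be the set of components of $G-X$ and, for $Y\subseteq X$, let $\mathcal C_X(Y)=\{C\in\mathcal C_X : N(C)=Y\}$. A finite set $X\subseteq V$ is critical if $\mathcal C_X(X)$ is infinite, and $\mathrm{crit}(G)$ is the set of all critical sets. - For an $\aleph_0$-tangle $\tau$ and finite $X\subseteq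 V$ let $U(\tau,X)$ be the set of all $\mathcal C\subseteq\mathcal C_X$ with $(V\setminus\bigcup_{C\in\mathcal C}V(C),\,X\cup\bigcup_{C\in\mathcal C}V(C))\in\tau$. Let $\mathcal X_\tau$ be the set of all finite $X$ for which $U(\tau,X)$ is a free (that is, non-principal) ultrafilter on $\mathcal C_X$. An ultrafilter tangle is an $\aleph_0$-tangle $\tau$ with $\mathcal X_\tau\neq\emptyset$, and $\Upsilon$ is the set of all ultrafilter tangles. For every $\tau\in\Upsilon$ the set $\mathcal X_\tau$ has a least element with respect to inclusion, denoted by $X_\tau$; write $\tau\sim\tau'$ if $X_\tau=X_{\tau'}$. Then: 1. The map $[\tau]_\sim\mapsto X_\tau$ is a bijection between $\Upsilon/{\sim}$ and $\mathrm{crit}(G)$. 2. For every $X\in\mathrm{crit}(G)$ the map $\tau\mapsto U(\tau,X)\cap 2^{\mathcal C_X(X)}$ is a bijection between the set of ultrafilter tangles $\tau$ with $X_\tau=X$ and the set of free ultrafilters on $\mathcal C_X(X)$. Moreover, the number of ultrafilter tangles $\tau$ with $X_\tau=X$ is $2^{2^\kappa}$, where $\kappa=|\mathcal C_X(X)|\ge\aleph_0$.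 3. $|\mathrm{crit}(G)|\le|V|$. 4. $|\mathrm{crit}(G)|\cdot 2^{\mathfrak c}\le|\Upsilon|$, where $\mathfrak c=2^{\aleph_0}$. -/

import Mathlib

open Cardinal

namespace TangleCrit

universe u

variable {V : Type u}

/-! ### Separations, orientations, stars and tangles

An oriented separation is an ordered pair `(A, B)` of vertex sets, with small side `A` and big
side `B`. A collection of unoriented separations `{A, B}` is represented by the set of all its
orientations `(A, B)` and `(B, A)`. -/

/-- The set of all orientations of finite order separations `{A, B}` of `G`. -/
def finiteOrderSeps (G : SimpleGraph V) : Set (Set V × Set V) :=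
  {s | (s.1 ∩ s.2).Finite ∧ s.1 ∪ s.2 = Set.univ ∧
    ∀ a ∈ s.1 \ s.2, ∀ b ∈ s.2 \ s.1, ¬ G.Adj a b}

/-- `(A, B) ≤ (C, D)` if and only if `A ⊆ C` and `B ⊇ D`. -/
def SepLE (r s : Set V × Set V) : Prop := r.1 ⊆ s.1 ∧ s.2 ⊆ r.2

def SepLT (r s : Set V × Set V) : Prop := SepLE r s ∧ r ≠ s

/-- `O` is an orientation of `S`: a subset of `S` that contains precisely one of `(A, B)` and
`(B, A)` for each separation in `S`. -/
def IsOrientation (S O : Set (Set V × Set V)) : Prop :=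
  O ⊆ S ∧ ∀ s ∈ S, Xor (s ∈ O) (s.swap ∈ O)

/-- No two distinct members `(B, A)` and `(C, D)` of `O` satisfy `(A, B) < (C, D)`. -/
def IsConsistent (O : Set (Set V × Set V)) : Prop :=
  ∀ r ∈ O, ∀ s ∈ O, r ≠ s → ¬ SepLT r.swap s

/-- `σ` is a star in `S`: any two distinct members `(A, B)` and `(D, C)` of `σ` point towards each
other, that is, `(A, B) ≤ (C, D)`. -/
def IsStar (S σ : Set (Set V × Set V)) : Prop :=
  σ ⊆ S ∧ ∀ r ∈ σ, ∀ s ∈ σ, r ≠ s → SepLE r s.swap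

/-- The interior of a star is the intersection of all the big sides. -/
def starInterior (σ : Set (Set V × Set V)) : Set V := ⋂ s ∈ σ, s.2

/-- An `F`-tangle of `S`: a consistent orientation of `S` that has no subset in `F`. -/
def IsTangle (S : Set (Set V × Set V)) (F : Set (Set (Set V × Set V)))
    (τ : Set (Set V × Set V)) : Prop :=
  IsOrientation S τ ∧ IsConsistent τ ∧ ∀ σ ∈ F, ¬ σ ⊆ τ

/-- All finite stars of finite interior in the set of finite order separations of `G`. -/
def finiteStars (G : SimpleGraph V) : Set (Set (Set V × Set V)) :=
  {σ | IsStar (finiteOrderSeps G) σ ∧ σ.Finite ∧ (starInterior σ).Finite}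

/-- The set `Θ` of all `ℵ₀`-tangles of `G`. -/
def alephZeroTangles (G : SimpleGraph V) : Set (Set (Set V × Set V)) :=
  {τ | IsTangle (finiteOrderSeps G) (finiteStars G) τ}

/-! ### Components and critical vertex sets

The set of components of `G - X` is `G.ComponentCompl X`. -/

/-- The neighbourhood `N(A)` of a vertex set `A`: the vertices outside `A` with a neighbour
in `A`. -/
def nbhd (G : SimpleGraph V) (A : Set V) : Set V := {v | v ∉ A ∧ ∃ u ∈ A, G.Adj u v}

/-- The collection of all components `C` of `G - X` with `N(C) = Y`. -/
def compsWithNbhd (G : SimpleGraph V) (X Y : Finset V) : Set (G.ComponentCompl (X : Set V)) :=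
  {C | nbhd G (C : Set V) = (Y : Set V)}

/-- The set `crit(G)` of all critical vertex sets of `G`. -/
def crit (G : SimpleGraph V) : Set (Finset V) := {X | (compsWithNbhd G X X).Infinite}

/-! ### Ultrafilters induced by tangles -/

/-- The set of all vertices contained in members of a collection `𝒞` of components of `G - X`. -/
def compVerts {G : SimpleGraph V} {X : Finset V} (𝒞 : Set (G.ComponentCompl (X : Set V))) :
    Set V := ⋃ C ∈ 𝒞, (C : Set V)

/-- The oriented separation `s_{X → 𝒞} = (V \ V[𝒞], X ∪ V[𝒞])`. -/
def sepTowards {G : SimpleGraph V} {X : Finset V} (𝒞 : Set (G.ComponentCompl (X : Set V))) :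
    Set V × Set V := ((compVerts 𝒞)ᶜ, (X : Set V) ∪ compVerts 𝒞)

/-- `U(τ, X)`, as a family of sets of components of `G - X`. -/
def inducedFamily (G : SimpleGraph V) (τ : Set (Set V × Set V)) (X : Finset V) :
    Set (Set (G.ComponentCompl (X : Set V))) := {𝒞 | sepTowards 𝒞 ∈ τ}

/-- The free (that is, non-principal) ultrafilters on `α`, each given as the family of its
member sets. -/
def freeUltrafilters (α : Type u) : Set (Set (Set α)) :=
  {F | ∃ U : Ultrafilter α, (∀ a : α, U ≠ pure a) ∧ F = {A : Set α | A ∈ U}}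

/-- `𝒳_τ`, the collection of all finite `X` for which `U(τ, X)` is a free ultrafilter. -/
def freeSets (G : SimpleGraph V) (τ : Set (Set V × Set V)) : Set (Finset V) :=
  {X | inducedFamily G τ X ∈ freeUltrafilters (G.ComponentCompl (X : Set V))}

/-- The set `Υ` of all ultrafilter tangles of `G`. -/
def ultrafilterTangles (G : SimpleGraph V) : Set (Set (Set V × Set V)) :=
  {τ | τ ∈ alephZeroTangles G ∧ (freeSets G τ).Nonempty}

open Classical in
/-- `X_τ`, the least element of `𝒳_τ` (and the empty set if there is no least element). -/
noncomputable def leastFree (G : SimpleGraph V) (τ : Set (Set V × Set V)) : Finset V :=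
  if h : ∃ X, IsLeast (freeSets G τ) X then h.choose else ∅

/-- The equivalence relation on `Υ` with `τ ∼ τ'` if and only if `X_τ = X_τ'`. -/
noncomputable def tangleSetoid (G : SimpleGraph V) : Setoid (ultrafilterTangles G) :=
  Setoid.ker fun τ => leastFree G (τ : Set (Set V × Set V))

/-- The map `[τ] ↦ X_τ` on `Υ/∼`. -/
noncomputable def classToSet (G : SimpleGraph V) : Quotient (tangleSetoid G) → Finset V :=
  Quotient.lift (fun τ : ultrafilterTangles G => leastFree G (τ : Set (Set V × Set V)))
    fun _ _ h => h

/-- The set of all ultrafilter tangles `τ` with `X_τ = X`. -/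
def tanglesAt (G : SimpleGraph V) (X : Finset V) : Set (Set (Set V × Set V)) :=
  {τ | τ ∈ ultrafilterTangles G ∧ leastFree G τ = X}

/-- The trace of `U(τ, X)` on the set of all components of `G - X` with neighbourhood `X`: those
members of `U(τ, X)` which are sets of such components. -/
def inducedTrace (G : SimpleGraph V) (X : Finset V) (τ : Set (Set V × Set V)) :
    Set (Set (compsWithNbhd G X X)) :=
  {D | (Subtype.val '' D) ∈ inducedFamily G τ X}

end TangleCrit

open TangleCrit

-- The big sides of an ℵ₀-tangle `τ` are infinite and closed under finite intersection up to finite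
-- sets (`sup_mem`, `mem_of_finite_diff`), so each `U(τ, X)` is an ultrafilter. Components of `G -
-- X` have only finitely many possible neighbourhoods `Y ⊆ X`, so `U(τ, X)` contains some `𝒞_X(Y)`.
-- If `U(τ, X)` is free, this `Y` is the least element of `𝒳_τ` (`isLeast_freeSets`); hence the
-- least element `X` satisfies `𝒞_X(X) ∈ U(τ, X)` and is critical.
--
-- A free `U(τ, X)` determines `τ`, because all but finitely many components of `G - X` avoid a
-- given finite separator and so lie on one side (`mem_iff_of_mem_freeSets`). Conversely, a free
-- ultrafilter on `𝒞_X(X)` is pushed forward to `V` by choosing a vertex in each component, and the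
-- separations with big side in the image form the required tangle. The cardinalities then follow
-- from Pospíšil's theorem.

universe u

/-! ### Counting ultrafilters on an infinite set. -/

/-- The members of Hausdorff's independent family on pairs of finite sets. -/
def hausdorffSet {α : Type u} (S : Set α) : Set (Finset α × Finset (Finset α)) :=
  {p | ∃ E ∈ p.2, (E : Set α) = (p.1 : Set α) ∩ S}

/-- One point of the symmetric difference of each pair of distinct members suffices. -/
theorem exists_finset_separating {α : Type u} (I : Finset (Set α)) :
    ∃ F : Finset α, ∀ S ∈ I, ∀ T ∈ I, (F : Set α) ∩ S = (F : Set α) ∩ T → S = T := by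
  classical
  rcases isEmpty_or_nonempty α with h | h
  · exact ⟨∅, fun S _ T _ _ => Subsingleton.elim S T⟩
  have key : ∀ p : Set α × Set α, ∃ x, p.1 ≠ p.2 → ¬ (x ∈ p.1 ↔ x ∈ p.2) := by
    intro p
    by_cases hp : p.1 = p.2
    · exact ⟨Classical.arbitrary α, fun h => (h hp).elim⟩
    · by_contra! hc
      exact hp (Set.ext fun x => (hc x).2)
  choose f hf using key
  refine ⟨(I ×ˢ I).image f, fun S hS T hT h => ?_⟩
  by_contra hne
  have hx : f (S, T) ∈ (((I ×ˢ I).image f : Finset α) : Set α) :=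
    Finset.mem_coe.2 (Finset.mem_image_of_mem f (Finset.mk_mem_product hS hT))
  have := Set.ext_iff.1 h (f (S, T))
  simp only [Set.mem_inter_iff, hx, true_and] at this
  exact hf (S, T) hne this

theorem exists_ultrafilter_hausdorffSet {α : Type u} (g : Set (Set α)) :
    ∃ U : Ultrafilter (Finset α × Finset (Finset α)), ∀ S, hausdorffSet S ∈ U ↔ S ∈ g := by
  classical
  let f : Set α → Set (Finset α × Finset (Finset α)) :=
    fun S => if S ∈ g then hausdorffSet S else (hausdorffSet S)ᶜ
  obtain ⟨U, hU⟩ := Ultrafilter.exists_ultrafilter_of_finite_inter_nonempty (Set.range f) (by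
    intro T hT
    rw [← Set.image_univ, Finset.subset_set_image_iff] at hT
    obtain ⟨I, -, rfl⟩ := hT
    obtain ⟨F, hF⟩ := exists_finset_separating I
    -- The second coordinate lists the traces on `F` of the members of `g`; as `F` separates `I`, no
    -- other member of `I` has a listed trace.
    refine ⟨(F, (I.filter (· ∈ g)).image fun S => F.filter (· ∈ S)), ?_⟩
    simp only [Finset.coe_image, Set.sInter_image, Set.mem_iInter]
    intro S hS
    by_cases hg : S ∈ g
    · simp only [f, if_pos hg]
      refine ⟨F.filter (· ∈ S), Finset.mem_image_of_mem _ (Finset.mem_filter.2 ⟨hS, hg⟩), ?_⟩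
      ext; simp
    · simp only [f, if_neg hg]
      rintro ⟨E, hE, h⟩
      obtain ⟨T, hT, rfl⟩ := Finset.mem_image.1 hE
      obtain ⟨hT, hTg⟩ := Finset.mem_filter.1 hT
      have : T = S := hF T hT S hS (by rw [← h]; ext; simp)
      exact hg (this ▸ hTg))
  refine ⟨U, fun S => ?_⟩
  have h : f S ∈ U := hU ⟨S, rfl⟩
  by_cases hg : S ∈ g
  · simpa [f, hg] using h
  · simpa [f, hg, Ultrafilter.compl_mem_iff_notMem] using h

/-- **Pospíšil's theorem**: there are `2 ^ 2 ^ κ` ultrafilters on an infinite set of size `κ`. -/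
theorem mk_ultrafilter (α : Type u) [Infinite α] :
    #(Ultrafilter α) = 2 ^ ((2 : Cardinal.{u}) ^ #α) := by
  rw [← mk_set, ← mk_set]
  apply le_antisymm
  · exact mk_le_of_injective (f := fun U : Ultrafilter α => {A : Set α | A ∈ U})
      fun U W h => Ultrafilter.ext fun A => Set.ext_iff.1 h A
  · have e : #(Finset α × Finset (Finset α)) = #α := by
      simp [mk_prod, mk_finset_of_infinite]
    obtain ⟨e⟩ := Cardinal.eq.1 e
    choose U hU using exists_ultrafilter_hausdorffSet (α := α)
    refine mk_le_of_injective (f := fun g => (U g).map e) fun g h hgh => ?_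
    ext S
    have := congrArg (fun W : Ultrafilter α => e.symm ⁻¹' hausdorffSet S ∈ W) hgh
    simpa [Ultrafilter.mem_map, ← Set.preimage_comp, hU] using this

theorem mk_freeUltrafilters (α : Type u) [Infinite α] :
    #(freeUltrafilters α) = 2 ^ ((2 : Cardinal.{u}) ^ #α) := by
  have hc : #(Set.range (pure : α → Ultrafilter α)) < #(Ultrafilter α) := by
    rw [mk_range_eq _ Ultrafilter.pure_injective, mk_ultrafilter]
    exact (cantor _).trans (cantor _)
  have : Infinite (Ultrafilter α) := Infinite.of_injective _ Ultrafilter.pure_injective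
  rw [← mk_ultrafilter, ← mk_compl_of_infinite _ hc]
  have : freeUltrafilters α = (fun U : Ultrafilter α => {A : Set α | A ∈ U}) ''
      (Set.range (pure : α → Ultrafilter α))ᶜ := by
    ext F
    constructor
    · rintro ⟨U, hU, rfl⟩
      exact ⟨U, fun ⟨a, ha⟩ => hU a ha.symm, rfl⟩
    · rintro ⟨U, hU, rfl⟩
      exact ⟨U, fun a ha => hU ⟨a, ha.symm⟩, rfl⟩
  rw [this, mk_image_eq]
  exact fun U W h => Ultrafilter.ext fun A => Set.ext_iff.1 h A

namespace TangleCrit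

variable {V : Type u} {G : SimpleGraph V}

/-! ### Closure properties of ℵ₀-tangles. -/

theorem swap_mem_finiteOrderSeps {s : Set V × Set V} (hs : s ∈ finiteOrderSeps G) :
    s.swap ∈ finiteOrderSeps G :=
  ⟨by simpa [Set.inter_comm] using hs.1, by simpa [Set.union_comm] using hs.2.1,
    fun a ha b hb hab => hs.2.2 b hb a ha hab.symm⟩

theorem sup_mem_finiteOrderSeps {r s : Set V × Set V} (hr : r ∈ finiteOrderSeps G)
    (hs : s ∈ finiteOrderSeps G) : (r.1 ∪ s.1, r.2 ∩ s.2) ∈ finiteOrderSeps G := by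
  have hr' : ∀ x, x ∈ r.1 ∨ x ∈ r.2 := fun x => by
    simpa using Set.ext_iff.1 hr.2.1 x
  have hs' : ∀ x, x ∈ s.1 ∨ x ∈ s.2 := fun x => by
    simpa using Set.ext_iff.1 hs.2.1 x
  refine ⟨(hr.1.union hs.1).subset ?_, ?_, ?_⟩
  · rintro x ⟨h1 | h1, h2, h3⟩
    · exact Or.inl ⟨h1, h2⟩
    · exact Or.inr ⟨h1, h3⟩
  · ext x
    have := hr' x
    have := hs' x
    simp only [Set.mem_union, Set.mem_inter_iff, Set.mem_univ, iff_true]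
    tauto
  · rintro a ⟨-, ha⟩ b ⟨⟨hb1, hb2⟩, hb⟩ hab
    simp only [Set.mem_union, not_or, Set.mem_inter_iff, not_and_or] at ha hb
    rcases ha with ha | ha
    · exact hr.2.2 a ⟨(hr' a).resolve_right ha, ha⟩ b ⟨hb1, hb.1⟩ hab
    · exact hs.2.2 a ⟨(hs' a).resolve_right ha, ha⟩ b ⟨hb2, hb.2⟩ hab

section Tangle

variable {τ : Set (Set V × Set V)} (hτ : τ ∈ alephZeroTangles G)
include hτ

theorem swap_notMem {s : Set V × Set V} (hs : s ∈ τ) : s.swap ∉ τ := by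
  rcases hτ.1.2 s (hτ.1.1 hs) with h | h
  · exact h.2
  · exact (h.2 hs).elim

theorem swap_mem_of_notMem {s : Set V × Set V} (hS : s ∈ finiteOrderSeps G) (hs : s ∉ τ) :
    s.swap ∈ τ := by
  rcases hτ.1.2 s hS with h | h
  · exact (hs h.1).elim
  · exact h.1

theorem snd_infinite {s : Set V × Set V} (hs : s ∈ τ) : s.2.Infinite := by
  intro hfin
  refine hτ.2.2 {s} ⟨⟨by simpa using hτ.1.1 hs, ?_⟩, Set.finite_singleton s, ?_⟩ (by simpa using hs)
  · rintro r rfl t rfl h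
    exact (h rfl).elim
  · simpa [starInterior] using hfin

theorem mem_of_sepLE {r s : Set V × Set V} (hs : s ∈ τ) (hr : r ∈ finiteOrderSeps G)
    (h : SepLE r s) : r ∈ τ := by
  by_contra hn
  have hr' := swap_mem_of_notMem hτ hr hn
  have hrs : r ≠ s := fun e => hn (e ▸ hs)
  -- Consistency speaks only of distinct members. In the degenerate case `s = r.swap`, the big side
  -- `r.1` of `s` lies in the finite separator.
  by_cases e : r.swap = s
  · subst e
    refine snd_infinite hτ hs (hr.1.subset fun x hx => ⟨hx, h.1 hx⟩)
  · exact hτ.2.1 _ hr' _ hs e ⟨by simpa using h, by simpa using hrs⟩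

theorem sup_mem {r s : Set V × Set V} (hr : r ∈ τ) (hs : s ∈ τ) :
    (r.1 ∪ s.1, r.2 ∩ s.2) ∈ τ := by
  have hrS := hτ.1.1 hr
  have hsS := hτ.1.1 hs
  have hS := sup_mem_finiteOrderSeps hrS hsS
  by_contra hn
  have h1 := swap_mem_of_notMem hτ hS hn
  have hmS : (s.1 ∩ r.2, s.2 ∪ r.1) ∈ finiteOrderSeps G :=
    swap_mem_finiteOrderSeps (sup_mem_finiteOrderSeps (swap_mem_finiteOrderSeps hsS) hrS)
  have h2 : (s.1 ∩ r.2, s.2 ∪ r.1) ∈ τ :=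
    mem_of_sepLE hτ hs hmS ⟨Set.inter_subset_left, Set.subset_union_left⟩
  -- Shrinking `s` to avoid overlap with `r` turns `r`, `s` and the inverse of their supremum into a
  -- star, whose interior lies in the union of the two finite separators.
  refine hτ.2.2 {r, (s.1 ∩ r.2, s.2 ∪ r.1), (r.2 ∩ s.2, r.1 ∪ s.1)} ⟨⟨?_, ?_⟩, ?_, ?_⟩ ?_
  · rintro t (rfl | rfl | rfl)
    exacts [hrS, hmS, hτ.1.1 h1]
  · rintro t (rfl | rfl | rfl) t' (rfl | rfl | rfl) hne
    all_goals first
      | exact (hne rfl).elim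
      | (constructor <;> intro x hx <;>
          simp only [Prod.fst_swap, Prod.snd_swap, Set.mem_inter_iff, Set.mem_union] at hx ⊢ <;>
          tauto)
  · exact Set.toFinite _
  · refine (hrS.1.union hsS.1).subset fun x hx => ?_
    simp only [starInterior, Set.mem_insert_iff, Set.mem_singleton_iff, Set.iInter_iInter_eq_or_left,
      Set.iInter_iInter_eq_left, Set.mem_inter_iff, Set.mem_union] at hx ⊢
    tauto
  · rintro t (rfl | rfl | rfl)
    exacts [hr, h2, h1]

theorem inter_snd_infinite {r s : Set V × Set V} (hr : r ∈ τ) (hs : s ∈ τ) :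
    (r.2 ∩ s.2).Infinite :=
  snd_infinite hτ (sup_mem hτ hr hs)

/-- An `ℵ₀`-tangle only depends on the big sides of its elements up to finite sets. -/
theorem mem_of_finite_diff {r s : Set V × Set V} (hr : r ∈ τ) (hs : s ∈ finiteOrderSeps G)
    (h : (r.2 \ s.2).Finite) : s ∈ τ := by
  by_contra hn
  refine inter_snd_infinite hτ hr (swap_mem_of_notMem hτ hs hn) ((h.union hs.1).subset ?_)
  rintro x ⟨hx1, hx2⟩
  by_cases hx : x ∈ s.2
  · exact Or.inr ⟨hx2, hx⟩
  · exact Or.inl ⟨hx1, hx⟩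

end Tangle

/-! ### Components -/

section Components

variable {X : Finset V}

theorem mem_compVerts {𝒞 : Set (G.ComponentCompl (X : Set V))} {v : V} :
    v ∈ compVerts 𝒞 ↔ ∃ C ∈ 𝒞, v ∈ C := by
  simp [compVerts]

theorem eq_of_mem_of_mem {K : Set V} {C D : G.ComponentCompl K} {v : V} (hC : v ∈ C)
    (hD : v ∈ D) : C = D := by
  by_contra h
  exact Set.disjoint_left.1 (SimpleGraph.ComponentCompl.pairwise_disjoint h) hC hD

theorem compVerts_compl (𝒞 : Set (G.ComponentCompl (X : Set V))) :
    compVerts 𝒞ᶜ = ((X : Set V) ∪ compVerts 𝒞)ᶜ := by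
  ext v
  simp only [mem_compVerts, Set.mem_compl_iff, Set.mem_union, not_or, not_exists, not_and]
  constructor
  · rintro ⟨C, hC, hv⟩
    exact ⟨C.notMem_of_mem hv, fun D hD hvD => hC (eq_of_mem_of_mem hv hvD ▸ hD)⟩
  · rintro ⟨hX, h⟩
    exact ⟨G.componentComplMk hX, fun hC => h _ hC (G.componentComplMk_mem hX),
      G.componentComplMk_mem hX⟩

theorem swap_sepTowards (𝒞 : Set (G.ComponentCompl (X : Set V))) :
    (sepTowards 𝒞).swap = sepTowards 𝒞ᶜ := by
  have h := compVerts_compl 𝒞ᶜ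
  rw [compl_compl] at h
  refine Prod.ext ?_ ?_
  · change _ = (compVerts 𝒞ᶜ)ᶜ
    rw [compVerts_compl, compl_compl]
    rfl
  · change (compVerts 𝒞)ᶜ = _
    rw [h, compl_compl]
    rfl

theorem sepTowards_mem_finiteOrderSeps (𝒞 : Set (G.ComponentCompl (X : Set V))) :
    sepTowards 𝒞 ∈ finiteOrderSeps G := by
  refine ⟨X.finite_toSet.subset ?_, ?_, ?_⟩
  · rintro v ⟨h1, h2 | h2⟩
    exacts [h2, (h1 h2).elim]
  · ext v
    simp only [sepTowards, Set.mem_union, Set.mem_compl_iff, Set.mem_univ, iff_true]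
    tauto
  · rintro a ⟨ha1, ha2⟩ b ⟨-, hb⟩ hab
    simp only [sepTowards, Set.mem_compl_iff, not_not, Set.mem_union, not_or] at ha1 ha2 hb
    obtain ⟨C, hC, hbC⟩ := mem_compVerts.1 hb
    exact ha1 (mem_compVerts.2 ⟨C, hC, C.mem_of_adj b a hbC ha2.1 hab.symm⟩)

theorem nbhd_subset (C : G.ComponentCompl (X : Set V)) : nbhd G (C : Set V) ⊆ X := by
  rintro v ⟨hv, u, hu, huv⟩
  by_contra h
  exact hv (C.mem_of_adj u v hu h huv)

/-- Connectedness of `C` enters the arguments below through this lemma: membership in `W` propagates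
along walks in `C`. -/
theorem componentCompl_subset_of_closed {K W : Set V} (C : G.ComponentCompl K) {v : V}
    (hvC : v ∈ C) (hvW : v ∈ W)
    (h : ∀ a ∈ C, a ∈ W → ∀ b ∈ C, G.Adj a b → b ∈ W) : (C : Set V) ⊆ W := by
  have key : ∀ {a b : (Kᶜ : Set V)} (_ : (G.induce Kᶜ).Walk a b),
      (a : V) ∈ C → (a : V) ∈ W → (b : V) ∈ W := by
    intro a b p
    induction p with
    | nil => exact fun _ hW => hW
    | @cons a c b hac p ih =>
      intro haC haW
      have hcC : (c : V) ∈ C := C.mem_of_adj a c haC c.2 hac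
      exact ih hcC (h a haC haW c hcC hac)
  intro w hwC
  obtain ⟨hvK, hv⟩ := hvC
  obtain ⟨hwK, hw⟩ := hwC
  obtain ⟨p⟩ := SimpleGraph.ConnectedComponent.exact (hv.trans hw.symm)
  exact key p ⟨hvK, hv⟩ hvW

/-- No edge of `G - K` leaves `C`, so `C` is already a component of `G - K`. -/
theorem coe_hom_eq_of_nbhd_subset {K L : Set V} (h : K ⊆ L) (C : G.ComponentCompl L)
    (hC : nbhd G (C : Set V) ⊆ K) : ((C.hom h : G.ComponentCompl K) : Set V) = C := by
  refine (Set.Subset.antisymm ?_ (C.subset_hom h))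
  obtain ⟨v, hv⟩ := C.nonempty
  refine componentCompl_subset_of_closed (W := (C : Set V)) _ (C.subset_hom h hv) hv ?_
  intro a _ haC b hb hab
  by_contra hbC
  exact (C.hom h).notMem_of_mem hb (hC ⟨hbC, a, haC, hab⟩)

theorem subset_or_subset_of_disjoint {K : Set V} (C : G.ComponentCompl K) {s : Set V × Set V}
    (hs : s ∈ finiteOrderSeps G) (h : Disjoint (C : Set V) (s.1 ∩ s.2)) :
    (C : Set V) ⊆ s.1 ∨ (C : Set V) ⊆ s.2 := by
  have key : ∀ {s : Set V × Set V}, s ∈ finiteOrderSeps G → Disjoint (C : Set V) (s.1 ∩ s.2) →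
      ∀ v ∈ C, v ∈ s.1 → (C : Set V) ⊆ s.1 := by
    intro s hs h v hv hvs
    refine componentCompl_subset_of_closed C hv hvs fun a ha has b hb hab => ?_
    by_contra hbs
    have hbs' : b ∈ s.2 := by
      have := Set.ext_iff.1 hs.2.1 b
      simp only [Set.mem_union, Set.mem_univ, iff_true] at this
      exact this.resolve_left hbs
    exact hs.2.2 a ⟨has, fun ha2 => Set.disjoint_left.1 h ha ⟨has, ha2⟩⟩ b ⟨hbs', hbs⟩ hab
  obtain ⟨v, hv⟩ := C.nonempty
  have : v ∈ s.1 ∪ s.2 := hs.2.1 ▸ Set.mem_univ v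
  rcases this with h1 | h2
  · exact Or.inl (key hs h v hv h1)
  · exact Or.inr (key (swap_mem_finiteOrderSeps hs)
      (by simpa [Set.inter_comm] using h) v hv h2)

theorem finite_setOf_not_disjoint (K : Set V) {F : Set V} (hF : F.Finite) :
    {C : G.ComponentCompl K | ¬ Disjoint (C : Set V) F}.Finite := by
  have : (⋃ v ∈ F, {C : G.ComponentCompl K | v ∈ C}).Finite :=
    hF.biUnion fun v _ => Set.Subsingleton.finite fun C hC D hD => eq_of_mem_of_mem hC hD
  refine this.subset fun C hC => ?_
  obtain ⟨v, hvC, hvF⟩ := Set.not_disjoint_iff.1 hC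
  simp only [Set.mem_iUnion]
  exact ⟨v, hvF, hvC⟩

end Components

/-! ### The ultrafilters induced by a tangle. -/

theorem exists_ultrafilter_eq_inducedFamily {τ : Set (Set V × Set V)}
    (hτ : τ ∈ alephZeroTangles G) (X : Finset V) :
    ∃ U : Ultrafilter (G.ComponentCompl (X : Set V)), ∀ 𝒞, 𝒞 ∈ U ↔ sepTowards 𝒞 ∈ τ := by
  have hcompl : ∀ 𝒞 : Set (G.ComponentCompl (X : Set V)), sepTowards 𝒞ᶜ ∉ τ ↔ sepTowards 𝒞 ∈ τ := by
    intro 𝒞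
    rw [← swap_sepTowards]
    constructor
    · intro h
      by_contra hn
      exact h (swap_mem_of_notMem hτ (sepTowards_mem_finiteOrderSeps 𝒞) hn)
    · exact swap_notMem hτ
  let f : Filter (G.ComponentCompl (X : Set V)) :=
    { sets := inducedFamily G τ X
      univ_sets := by
        refine (hcompl _).1 fun h => snd_infinite hτ h ?_
        simp [sepTowards, compVerts]
      sets_of_superset := by
        intro 𝒞 𝒟 h hsub
        refine mem_of_finite_diff hτ h (sepTowards_mem_finiteOrderSeps _) ?_
        convert Set.finite_empty
        rw [Set.sdiff_eq_empty]
        exact Set.union_subset_union_right _ (Set.biUnion_subset_biUnion_left hsub)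
      inter_sets := by
        intro 𝒞 𝒟 h h'
        refine mem_of_finite_diff hτ (sup_mem hτ h h') (sepTowards_mem_finiteOrderSeps _) ?_
        convert Set.finite_empty
        rw [Set.sdiff_eq_empty]
        rintro v ⟨hv | hv, hv' | hv'⟩
        · exact Or.inl hv
        · exact Or.inl hv
        · exact Or.inl hv'
        · obtain ⟨C, hC, hvC⟩ := mem_compVerts.1 hv
          obtain ⟨D, hD, hvD⟩ := mem_compVerts.1 hv'
          obtain rfl := eq_of_mem_of_mem hvC hvD
          exact Or.inr (mem_compVerts.2 ⟨C, ⟨hC, hD⟩, hvC⟩) }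
  exact ⟨Ultrafilter.ofComplNotMemIff f hcompl, fun 𝒞 => Iff.rfl⟩

/-- The ultrafilter `U(τ, X)` induced by an `ℵ₀`-tangle `τ`. -/
noncomputable def inducedUltrafilter {τ : Set (Set V × Set V)} (hτ : τ ∈ alephZeroTangles G)
    (X : Finset V) : Ultrafilter (G.ComponentCompl (X : Set V)) :=
  (exists_ultrafilter_eq_inducedFamily hτ X).choose

theorem mem_inducedUltrafilter {τ : Set (Set V × Set V)} (hτ : τ ∈ alephZeroTangles G)
    {X : Finset V} {𝒞 : Set (G.ComponentCompl (X : Set V))} :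
    𝒞 ∈ inducedUltrafilter hτ X ↔ sepTowards 𝒞 ∈ τ :=
  (exists_ultrafilter_eq_inducedFamily hτ X).choose_spec 𝒞

theorem mem_freeSets_iff {τ : Set (Set V × Set V)} (hτ : τ ∈ alephZeroTangles G)
    {X : Finset V} : X ∈ freeSets G τ ↔ ∀ C, inducedUltrafilter hτ X ≠ pure C := by
  have h : inducedFamily G τ X = {A | A ∈ inducedUltrafilter hτ X} := by
    ext 𝒞
    exact (mem_inducedUltrafilter hτ).symm
  constructor
  · rintro ⟨U, hU, hf⟩
    have : inducedUltrafilter hτ X = U := Ultrafilter.ext fun A => by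
      exact Set.ext_iff.1 (h.symm.trans hf) A
    exact this ▸ hU
  · exact fun hU => ⟨_, hU, h⟩

theorem compl_mem_of_finite {α : Type*} {U : Ultrafilter α} (hU : ∀ a, U ≠ pure a) {F : Set α}
    (hF : F.Finite) : Fᶜ ∈ U := by
  by_contra h
  obtain ⟨a, -, ha⟩ := Ultrafilter.eq_pure_of_finite_mem hF (Ultrafilter.compl_notMem_iff.1 h)
  exact hU a ha

/-! ### The least element of `𝒳_τ`, and recovering `τ` from a free `U(τ, X)`. -/

section Least

variable {τ : Set (Set V × Set V)} (hτ : τ ∈ alephZeroTangles G)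
include hτ

theorem exists_compsWithNbhd_mem (X : Finset V) :
    ∃ Y ⊆ X, compsWithNbhd G X Y ∈ inducedUltrafilter hτ X := by
  have h : (⋃ Y ∈ (X.powerset : Set (Finset V)), compsWithNbhd G X Y) ∈
      inducedUltrafilter hτ X := by
    refine Filter.mem_of_superset Filter.univ_mem fun C _ => ?_
    have hfin := X.finite_toSet.subset (nbhd_subset C)
    simp only [Set.mem_iUnion]
    refine ⟨hfin.toFinset, ?_, ?_⟩
    · simpa using nbhd_subset C
    · simp [compsWithNbhd]
  rw [Ultrafilter.finite_biUnion_mem_iff X.powerset.finite_toSet] at h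
  obtain ⟨Y, hY, h⟩ := h
  exact ⟨Y, by simpa using hY, h⟩

/-- The members of `𝒞_X(Y)` are also components of `G - Y`. If `U(τ, Y)` were generated by one
component `C₀`, then removing `C₀` from `𝒞_X(Y)` would leave a set still in `U(τ, X)`, yet its big
side would meet that of `C₀` only in a finite set. -/
theorem mem_freeSets_of_compsWithNbhd_mem {X Y : Finset V} (hX : X ∈ freeSets G τ) (hYX : Y ⊆ X)
    (hY : compsWithNbhd G X Y ∈ inducedUltrafilter hτ X) : Y ∈ freeSets G τ := by
  rw [mem_freeSets_iff hτ] at hX ⊢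
  intro C₀ hC₀
  have h₀ : sepTowards {C₀} ∈ τ := by
    rw [← mem_inducedUltrafilter hτ, hC₀]
    exact rfl
  have hsub : {C : G.ComponentCompl (X : Set V) | (C : Set V) = C₀}.Finite :=
    Set.Subsingleton.finite fun C hC D hD => SetLike.coe_injective (hC.trans hD.symm)
  have h₁ := (mem_inducedUltrafilter hτ).1 (Filter.inter_mem hY (compl_mem_of_finite hX hsub))
  refine inter_snd_infinite hτ h₀ h₁ ((Y.finite_toSet.union X.finite_toSet).subset ?_)
  rintro v ⟨hv | hv, hv' | hv'⟩
  · exact Or.inl hv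
  · exact Or.inl hv
  · exact Or.inr hv'
  · exfalso
    obtain ⟨D, hD, hvD⟩ := mem_compVerts.1 hv
    obtain rfl : D = C₀ := hD
    obtain ⟨C, ⟨hC, hne⟩, hv'⟩ := mem_compVerts.1 hv'
    have he := coe_hom_eq_of_nbhd_subset (Finset.coe_subset.2 hYX) C (le_of_eq hC)
    have : v ∈ ((C.hom (Finset.coe_subset.2 hYX) : G.ComponentCompl (Y : Set V)) : Set V) :=
      he ▸ hv'
    rw [eq_of_mem_of_mem this hvD] at he
    exact hne he.symm

/-- If `X'` missed some `y ∈ Y`, all but finitely many members of `𝒞_X(Y)` would avoid `X'`; having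
`y` as a neighbour, they would lie in the component of `G - X'` containing `y`, making `U(τ, X')`
principal. -/
theorem isLeast_freeSets {X Y : Finset V} (hX : X ∈ freeSets G τ) (hYX : Y ⊆ X)
    (hY : compsWithNbhd G X Y ∈ inducedUltrafilter hτ X) : IsLeast (freeSets G τ) Y := by
  refine ⟨mem_freeSets_of_compsWithNbhd_mem hτ hX hYX hY, fun X' hX' y hy => ?_⟩
  rw [mem_freeSets_iff hτ] at hX hX'
  by_contra hyX'
  have hy' : y ∉ (X' : Set V) := hyX'
  have h₁ := (mem_inducedUltrafilter hτ).1 (Filter.inter_mem hY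
    (compl_mem_of_finite hX (finite_setOf_not_disjoint _ X'.finite_toSet)))
  suffices h : sepTowards {G.componentComplMk hy'} ∈ τ by
    obtain ⟨C, hC, hC'⟩ := Ultrafilter.eq_pure_of_finite_mem (Set.finite_singleton _)
      ((mem_inducedUltrafilter hτ).2 h)
    exact hX' C hC'
  refine mem_of_finite_diff hτ h₁ (sepTowards_mem_finiteOrderSeps _) (X.finite_toSet.subset ?_)
  rintro v ⟨hv | hv, hn⟩
  · exact hv
  · exfalso
    obtain ⟨C, ⟨hC, hd⟩, hv⟩ := mem_compVerts.1 hv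
    have hd : Disjoint (C : Set V) X' := not_not.1 hd
    refine hn (Or.inr (mem_compVerts.2 ⟨_, rfl, ?_⟩))
    have hyC : y ∈ nbhd G (C : Set V) := by
      rw [show nbhd G (C : Set V) = Y from hC]
      exact hy
    obtain ⟨-, u, hu, huy⟩ := hyC
    have hu' := (G.componentComplMk hy').mem_of_adj y u (G.componentComplMk_mem hy')
      (Set.disjoint_left.1 hd hu) huy.symm
    refine componentCompl_subset_of_closed (W := (G.componentComplMk hy' : Set V)) C hu hu' ?_ hv
    exact fun a _ ha b hb hab =>
      (G.componentComplMk hy').mem_of_adj a b ha (Set.disjoint_left.1 hd hb) hab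

theorem mem_crit_of_compsWithNbhd_mem {X : Finset V} (hX : X ∈ freeSets G τ)
    (h : compsWithNbhd G X X ∈ inducedUltrafilter hτ X) : X ∈ crit G := by
  intro hfin
  obtain ⟨C, -, hC⟩ := Ultrafilter.eq_pure_of_finite_mem hfin h
  exact (mem_freeSets_iff hτ).1 hX C hC

theorem compsWithNbhd_mem_of_isLeast {X : Finset V} (hX : IsLeast (freeSets G τ) X) :
    compsWithNbhd G X X ∈ inducedUltrafilter hτ X := by
  obtain ⟨Y, hYX, hY⟩ := exists_compsWithNbhd_mem hτ X
  obtain rfl := (isLeast_freeSets hτ hX.1 hYX hY).unique hX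
  exact hY

theorem mem_iff_of_mem_freeSets {X : Finset V} (hX : X ∈ freeSets G τ) {s : Set V × Set V}
    (hs : s ∈ finiteOrderSeps G) :
    s ∈ τ ↔ {C : G.ComponentCompl (X : Set V) | (C : Set V) ⊆ s.2} ∈ inducedFamily G τ X := by
  have key : ∀ {s : Set V × Set V}, s ∈ finiteOrderSeps G →
      {C : G.ComponentCompl (X : Set V) | (C : Set V) ⊆ s.2} ∈ inducedFamily G τ X → s ∈ τ := by
    intro s hs h
    refine mem_of_finite_diff hτ h hs (X.finite_toSet.subset ?_)
    rintro v ⟨hv | hv, hn⟩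
    · exact hv
    · obtain ⟨C, hC, hv⟩ := mem_compVerts.1 hv
      exact (hn (hC hv)).elim
  refine ⟨fun h => ?_, key hs⟩
  by_contra hn
  -- Almost every component lies on one side of `s`; if the big side does not win in the
  -- ultrafilter, the small side does, and then `key` puts the swap of `s` into `τ`.
  refine swap_notMem hτ h (key (swap_mem_finiteOrderSeps hs) ((mem_inducedUltrafilter hτ).1 ?_))
  have hn' := Ultrafilter.compl_mem_iff_notMem.2 fun hn' => hn ((mem_inducedUltrafilter hτ).1 hn')
  refine Filter.mem_of_superset (Filter.inter_mem hn' (compl_mem_of_finite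
    ((mem_freeSets_iff hτ).1 hX) (finite_setOf_not_disjoint _ hs.1))) ?_
  rintro C ⟨hC, hd⟩
  exact (subset_or_subset_of_disjoint C hs (not_not.1 hd)).resolve_right hC

end Least

theorem eq_of_inducedFamily_eq {τ τ' : Set (Set V × Set V)} (hτ : τ ∈ alephZeroTangles G)
    (hτ' : τ' ∈ alephZeroTangles G) {X : Finset V} (hX : X ∈ freeSets G τ)
    (h : inducedFamily G τ X = inducedFamily G τ' X) : τ = τ' := by
  have hX' : X ∈ freeSets G τ' := by
    unfold freeSets
    rw [Set.mem_ofPred_eq, ← h]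
    exact hX
  ext s
  constructor
  · intro hs
    rw [mem_iff_of_mem_freeSets hτ' hX' (hτ.1.1 hs), ← h]
    exact (mem_iff_of_mem_freeSets hτ hX (hτ.1.1 hs)).1 hs
  · intro hs
    rw [mem_iff_of_mem_freeSets hτ hX (hτ'.1.1 hs), h]
    exact (mem_iff_of_mem_freeSets hτ' hX' (hτ'.1.1 hs)).1 hs

theorem leastFree_eq {τ : Set (Set V × Set V)} {X : Finset V} (h : IsLeast (freeSets G τ) X) :
    leastFree G τ = X := by
  have hex : ∃ X, IsLeast (freeSets G τ) X := ⟨X, h⟩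
  rw [leastFree, dif_pos hex]
  exact hex.choose_spec.unique h

theorem isLeast_leastFree {τ : Set (Set V × Set V)} (hτ : τ ∈ ultrafilterTangles G) :
    IsLeast (freeSets G τ) (leastFree G τ) := by
  obtain ⟨hτ, X, hX⟩ := hτ
  obtain ⟨Y, hYX, hY⟩ := exists_compsWithNbhd_mem hτ X
  have h := isLeast_freeSets hτ hX hYX hY
  rwa [leastFree_eq h]

theorem leastFree_mem_crit {τ : Set (Set V × Set V)} (hτ : τ ∈ ultrafilterTangles G) :
    leastFree G τ ∈ crit G :=
  mem_crit_of_compsWithNbhd_mem hτ.1 (isLeast_leastFree hτ).1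
    (compsWithNbhd_mem_of_isLeast hτ.1 (isLeast_leastFree hτ))

/-! ### Constructing tangles from free ultrafilters. -/

/-- The tangle of all separations whose big side lies in a given ultrafilter. -/
def tangleOfUltrafilter (G : SimpleGraph V) (p : Ultrafilter V) : Set (Set V × Set V) :=
  {s | s ∈ finiteOrderSeps G ∧ s.2 ∈ p}

/-- A free ultrafilter contains no finite set. Two oppositely oriented sides cannot both belong to
it, since they meet finitely, and a finite star in the tangle has its interior in `p`. -/
theorem tangleOfUltrafilter_mem (p : Ultrafilter V) (hp : ∀ v, p ≠ pure v) :
    tangleOfUltrafilter G p ∈ alephZeroTangles G := by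
  have hfin : ∀ F : Set V, F.Finite → F ∉ p := fun F hF h =>
    Ultrafilter.compl_notMem_iff.2 h (compl_mem_of_finite hp hF)
  refine ⟨⟨fun s hs => hs.1, fun s hs => ?_⟩, ?_, ?_⟩
  · have h1 : s.1 ∈ p ∨ s.2 ∈ p := by
      rw [← Ultrafilter.union_mem_iff, hs.2.1]
      exact Filter.univ_mem
    have h2 : ¬ (s.1 ∈ p ∧ s.2 ∈ p) := fun h => hfin _ hs.1 (Filter.inter_mem h.1 h.2)
    have h3 := swap_mem_finiteOrderSeps hs
    simp only [tangleOfUltrafilter, Set.mem_ofPred_eq, hs, h3, true_and, Prod.snd_swap, Xor]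
    tauto
  · rintro r hr s hs - ⟨h, -⟩
    exact hfin _ hr.1.1 (Filter.mem_of_superset (Filter.inter_mem hr.2 hs.2)
      fun v hv => ⟨h.2 hv.2, hv.1⟩)
  · rintro σ ⟨-, hσ, hint⟩ hsub
    refine hfin _ hint ?_
    exact (Filter.biInter_mem hσ).2 fun s hs => (hsub hs).2

/-- Every free ultrafilter on the components with neighbourhood `X` comes from an ultrafilter
tangle. -/
theorem exists_tangle_of_freeUltrafilter {X : Finset V}
    (W : Ultrafilter (compsWithNbhd G X X)) (hW : ∀ C, W ≠ pure C) :
    ∃ τ ∈ tanglesAt G X, ∀ 𝒞 : Set (G.ComponentCompl (X : Set V)),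
      𝒞 ∈ inducedFamily G τ X ↔ (Subtype.val ⁻¹' 𝒞 : Set (compsWithNbhd G X X)) ∈ W := by
  have hne : ∀ C : compsWithNbhd G X X, ∃ v, v ∈ C.1 := fun C => C.1.nonempty
  choose f hf using hne
  have hinj : Function.Injective f := fun C D h =>
    Subtype.ext (eq_of_mem_of_mem (hf C) (h ▸ hf D))
  have hτ : tangleOfUltrafilter G (W.map f) ∈ alephZeroTangles G := by
    refine tangleOfUltrafilter_mem _ fun v hv => ?_
    have h : {v} ∈ W.map f := by
      rw [hv]
      exact rfl
    obtain ⟨C, -, hC⟩ := Ultrafilter.eq_pure_of_finite_mem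
      ((Set.finite_singleton v).preimage hinj.injOn) (Ultrafilter.mem_map.1 h)
    exact hW C hC
  have hmem : ∀ 𝒞 : Set (G.ComponentCompl (X : Set V)),
      𝒞 ∈ inducedFamily G (tangleOfUltrafilter G (W.map f)) X ↔
        (Subtype.val ⁻¹' 𝒞 : Set (compsWithNbhd G X X)) ∈ W := by
    intro 𝒞
    -- The chosen vertex of a component lies outside `X`, hence in the big side exactly when its
    -- component belongs to `𝒞`.
    have h : f ⁻¹' (sepTowards 𝒞).2 = Subtype.val ⁻¹' 𝒞 := by
      ext C
      constructor
      · rintro (h | h)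
        · exact (C.1.notMem_of_mem (hf C) h).elim
        · obtain ⟨D, hD, h⟩ := mem_compVerts.1 h
          obtain rfl := eq_of_mem_of_mem (hf C) h
          exact hD
      · exact fun h => Or.inr (mem_compVerts.2 ⟨_, h, hf C⟩)
    rw [← h]
    exact ⟨fun hs => hs.2, fun hs => ⟨sepTowards_mem_finiteOrderSeps 𝒞, hs⟩⟩
  have hX : X ∈ freeSets G (tangleOfUltrafilter G (W.map f)) := by
    rw [mem_freeSets_iff hτ]
    intro C hC
    have h : {C} ∈ inducedUltrafilter hτ X := by
      rw [hC]
      exact rfl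
    obtain ⟨D, -, hD⟩ := Ultrafilter.eq_pure_of_finite_mem
      ((Set.finite_singleton C).preimage Subtype.val_injective.injOn)
      ((hmem _).1 ((mem_inducedUltrafilter hτ).1 h))
    exact hW D hD
  have hmemX : compsWithNbhd G X X ∈ inducedUltrafilter hτ X := by
    refine (mem_inducedUltrafilter hτ).2 ((hmem _).2 ?_)
    rw [Subtype.coe_preimage_self]
    exact Filter.univ_mem
  exact ⟨_, ⟨⟨hτ, X, hX⟩, leastFree_eq (isLeast_freeSets hτ hX subset_rfl hmemX)⟩, hmem⟩

/-! ### The bijections and the cardinalities. -/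

theorem isLeast_of_mem_tanglesAt {X : Finset V} {τ : Set (Set V × Set V)}
    (hτ : τ ∈ tanglesAt G X) : IsLeast (freeSets G τ) X := by
  obtain ⟨hτ, rfl⟩ := hτ
  exact isLeast_leastFree hτ

theorem mem_inducedFamily_iff_inducedTrace {X : Finset V} {τ : Set (Set V × Set V)}
    (hτ : τ ∈ tanglesAt G X) (𝒞 : Set (G.ComponentCompl (X : Set V))) :
    𝒞 ∈ inducedFamily G τ X ↔ Subtype.val ⁻¹' 𝒞 ∈ inducedTrace G X τ := by
  have h := compsWithNbhd_mem_of_isLeast hτ.1.1 (isLeast_of_mem_tanglesAt hτ)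
  change sepTowards 𝒞 ∈ τ ↔ sepTowards _ ∈ τ
  rw [← mem_inducedUltrafilter hτ.1.1, ← mem_inducedUltrafilter hτ.1.1,
    Subtype.image_preimage_coe]
  exact ⟨fun h' => Filter.inter_mem h h',
    fun h' => Filter.mem_of_superset h' Set.inter_subset_right⟩

theorem bijOn_inducedTrace (G : SimpleGraph V) (X : Finset V) :
    Set.BijOn (inducedTrace G X) (tanglesAt G X) (freeUltrafilters (compsWithNbhd G X X)) := by
  refine ⟨fun τ hτ => ?_, fun τ hτ τ' hτ' h => ?_, ?_⟩
  · have hl := isLeast_of_mem_tanglesAt hτ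
    have h := compsWithNbhd_mem_of_isLeast hτ.1.1 hl
    have hr : Set.range (Subtype.val : compsWithNbhd G X X → _) ∈ inducedUltrafilter hτ.1.1 X := by
      rwa [Subtype.range_coe]
    refine ⟨(inducedUltrafilter hτ.1.1 X).comap Subtype.val_injective hr, fun C hC => ?_, ?_⟩
    · have hC' : {C} ∈ (inducedUltrafilter hτ.1.1 X).comap Subtype.val_injective hr := by
        rw [hC]
        exact rfl
      rw [Ultrafilter.mem_comap] at hC'
      obtain ⟨D, -, hD⟩ := Ultrafilter.eq_pure_of_finite_mem
        ((Set.finite_singleton C).image _) hC'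
      exact (mem_freeSets_iff hτ.1.1).1 hl.1 D hD
    · ext D
      rw [Set.mem_ofPred_eq, Ultrafilter.mem_comap, mem_inducedUltrafilter hτ.1.1]
      exact Iff.rfl
  · refine eq_of_inducedFamily_eq hτ.1.1 hτ'.1.1 (isLeast_of_mem_tanglesAt hτ).1 ?_
    ext 𝒞
    rw [mem_inducedFamily_iff_inducedTrace hτ, mem_inducedFamily_iff_inducedTrace hτ', h]
  · rintro _ ⟨W, hW, rfl⟩
    obtain ⟨τ, hτ, h⟩ := exists_tangle_of_freeUltrafilter W hW
    refine ⟨τ, hτ, ?_⟩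
    ext D
    refine (h _).trans ?_
    rw [Set.preimage_image_eq _ Subtype.val_injective]
    exact Iff.rfl

theorem mk_tanglesAt {X : Finset V} (hX : X ∈ crit G) :
    #(tanglesAt G X) = 2 ^ ((2 : Cardinal) ^ #(compsWithNbhd G X X)) := by
  have : Infinite (compsWithNbhd G X X) := hX.to_subtype
  rw [← mk_freeUltrafilters]
  exact mk_congr (bijOn_inducedTrace G X).equiv

theorem bijOn_classToSet (G : SimpleGraph V) : Set.BijOn (classToSet G) Set.univ (crit G) := by
  refine ⟨?_, ?_, fun X hX => ?_⟩
  · rintro ⟨τ⟩ -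
    exact leastFree_mem_crit τ.2
  · rintro ⟨τ⟩ - ⟨τ'⟩ - h
    exact Quotient.sound h
  · have : Infinite (compsWithNbhd G X X) := hX.to_subtype
    obtain ⟨τ, hτ, -⟩ := exists_tangle_of_freeUltrafilter
      (Filter.hyperfilter (compsWithNbhd G X X)) fun C hC => by
        have h : {C} ∈ Filter.hyperfilter (compsWithNbhd G X X) := by
          rw [hC]
          exact rfl
        exact Filter.notMem_hyperfilter_of_finite (Set.finite_singleton C) h
    exact ⟨Quotient.mk _ ⟨τ, hτ.1⟩, trivial, hτ.2⟩

theorem mk_crit_le (G : SimpleGraph V) : #(crit G) ≤ #V := by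
  rcases (crit G).eq_empty_or_nonempty with h | ⟨X, hX⟩
  · simp [h]
  -- A finite `V` would leave only finitely many components, so no critical set.
  · have : Infinite V := by
      by_contra hfin
      rw [not_infinite_iff_finite] at hfin
      have : Finite (G.ComponentCompl (X : Set V)) :=
        Finite.of_injective (fun C => (C : Set V)) SetLike.coe_injective
      exact hX (Set.toFinite _)
    exact (mk_set_le _).trans (mk_finset_of_infinite V).le

theorem mk_crit_mul_le (G : SimpleGraph V) : #(crit G) * 2 ^ 𝔠 ≤ #(ultrafilterTangles G) := by
  -- The sets `tanglesAt G X` are disjoint for distinct `X`, because `τ` determines `X_τ`.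
  have h : #(Σ X : crit G, tanglesAt G (X : Finset V)) ≤ #(ultrafilterTangles G) := by
    refine mk_le_of_injective (f := fun p => ⟨p.2.1, p.2.2.1⟩) ?_
    rintro ⟨⟨X, hX⟩, τ, hτ⟩ ⟨⟨Y, hY⟩, τ', hτ'⟩ h
    obtain rfl : τ = τ' := congrArg Subtype.val h
    obtain rfl : X = Y := hτ.2.symm.trans hτ'.2
    rfl
  refine le_trans ?_ h
  rw [mk_sigma, ← sum_const']
  refine sum_le_sum _ _ fun X => ?_
  rw [mk_tanglesAt X.2]
  have : Infinite (compsWithNbhd G (X : Finset V) X) := X.2.to_subtype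
  refine power_le_power_left two_ne_zero ?_
  rw [← two_power_aleph0]
  exact power_le_power_left two_ne_zero (aleph0_le_mk _)

end TangleCrit

theorem theorem4p10 {V : Type*} (G : SimpleGraph V) :
    -- `X_τ` is well defined
    (∀ τ ∈ ultrafilterTangles G, IsLeast (freeSets G τ) (leastFree G τ)) ∧
    Set.BijOn (classToSet G) Set.univ (crit G) ∧
    (∀ X ∈ crit G,
      Set.BijOn (inducedTrace G X) (tanglesAt G X) (freeUltrafilters (compsWithNbhd G X X)) ∧
      ℵ₀ ≤ #(compsWithNbhd G X X) ∧
      #(tanglesAt G X) = 2 ^ ((2 : Cardinal) ^ #(compsWithNbhd G X X))) ∧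
    #(crit G) ≤ #V ∧
    #(crit G) * 2 ^ 𝔠 ≤ #(ultrafilterTangles G) := by
  refine ⟨fun τ hτ => isLeast_leastFree hτ, bijOn_classToSet G, fun X hX => ?_,
    mk_crit_le G, mk_crit_mul_le G⟩
  have : Infinite (compsWithNbhd G X X) := hX.to_subtype
  exact ⟨bijOn_inducedTrace G X, aleph0_le_mk _, mk_tanglesAt hX⟩
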